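/- Let $k\ge 1$ and let $n_1,\dots,n_k\ge 2$ be integers. Then there are complete deterministic finite automata $A_1,\dots,A_k$ over a common alphabet of $2k-1$ letters, where $A_i$ has exactly $n_i$ states, such that every complete DFA accepting the concatenation $L(A_1)L(A_2)\cdots L(A_k)$ has at least $$n_1 2^{n_2+\cdots+n_k}-D-\sum_{i=1}^{k-1}E_i$$ states. The numbers $D$ and $E_i$ are defined as follows. For $2\le j\le k+1$ let $T_j$ be the nested expression given by $T_{k+1}=1$ and $T_j=1+(2^{n_j}-1)T_{j+1}$, that is, $$T_j=1+(2^{n_j}-1)\bigl(1+(2^{n_{j+1}}-1)\bigl(1+\cdots\bigl(1+(2^{n_{k-1}}-1)2^{n_k}\bigr)\cdots\bigr)\bigr).$$ Then $$D=\sum_{t=2}^{k-1} n_1\Bigl(\prod_{j=2}^{t-1}(2^{n_j}-1)\Bigr)\bigl(2^{n_{t+1}+\cdots+n_k}-1\bigr),$$ $$E_i=\sum_{\substack{S\subseteq\{1,\dots,i\}\\ i\in S}}\Bigl(\prod_{j=1}^{i}c_j(S)\Bigr)\bigl(1+(2^{n_{i+1}-1}-1)\,T_{i+2}\bigr)\qquad(1\le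 i\le k-1),$$ where $c_1(S)=1$ if $1\in S$ and $c_1(S)=n_1-1$ if $1\notin S$, and for $2\le j\le i$ $$c_j(S)=\begin{cases}2^{n_j-2}&\text{if } j-1\in S,\\ 2^{n_j-1}&\text{if } j-1\notin S \text{ and } j\in S,\\ 2^{n_j-1}-1&\text{if } j-1\notin S\text{ and } j\notin S.\end{cases}$$ Empty sums are $0$ and empty products are $1$. For example, $E_1=1+(2^{n_2-1}-1)T_3$ and $E_2=\bigl((n_1-1)2^{n_2-1}+2^{n_2-2}\bigr)\bigl(1+(2^{n_3-1}-1)T_4\bigr)$. -/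

import Mathlib

/-- The nested expression
`1 + (2 ^ n_j - 1) (1 + (2 ^ n_{j+1} - 1) (1 + ⋯ (1 + (2 ^ n_{j+r-2} - 1) 2 ^ n_{j+r-1}) ⋯ ))`
in the `r` exponents `n_j, …, n_{j+r-1}`. It is `2 ^ n_j` for `r = 1`, and `1` for `r = 0`. -/
def catNest (n : ℕ → ℕ) : ℕ → ℕ → ℤ
  | _, 0 => 1
  | j, r + 1 => 1 + (2 ^ n j - 1) * catNest n (j + 1) r

/-- The number `D = ∑_{t=2}^{k-1} n_1 (2 ^ n_2 - 1) ⋯ (2 ^ n_{t-1} - 1) (2 ^ (n_{t+1} + ⋯ + n_k) - 1)`. -/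
def catD (k : ℕ) (n : ℕ → ℕ) : ℤ :=
  ∑ t ∈ Finset.Icc 2 (k - 1),
    (n 1 : ℤ) * (∏ j ∈ Finset.Icc 2 (t - 1), ((2 : ℤ) ^ n j - 1)) *
      ((2 : ℤ) ^ (∑ j ∈ Finset.Icc (t + 1) k, n j) - 1)

/-- The `j`-th factor of the summand of `E_i` that belongs to the set of positions `S`.
For `j = 1` it is `1` or `n_1 - 1`; for `j ≥ 2` it is `2 ^ (n_j - 2)` if `j - 1 ∈ S`, and otherwise
`2 ^ (n_j - 1)` or `2 ^ (n_j - 1) - 1`, according to whether `j ∈ S` or not. -/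
def catFactor (n : ℕ → ℕ) (S : Finset ℕ) (j : ℕ) : ℤ :=
  if j = 1 then (if 1 ∈ S then 1 else (n 1 : ℤ) - 1)
  else if j - 1 ∈ S then 2 ^ (n j - 2)
  else if j ∈ S then 2 ^ (n j - 1)
  else 2 ^ (n j - 1) - 1

/-- The number `E_i`, `1 ≤ i ≤ k - 1`. There is one summand for each set `S ⊆ {1, …, i}` that
contains `i`: from `(n_1 - 1) (2 ^ (n_2 - 1) - 1) ⋯ (2 ^ (n_{i-1} - 1) - 1) 2 ^ (n_i - 1)` for
`S = {i}` to `2 ^ (n_2 - 2) ⋯ 2 ^ (n_i - 2)` for `S = {1, …, i}`, each times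
`1 + (2 ^ (n_{i+1} - 1) - 1) (1 + (2 ^ n_{i+2} - 1) ⋯ (1 + (2 ^ n_{k-1} - 1) 2 ^ n_k) ⋯ )`. -/
def catE (k : ℕ) (n : ℕ → ℕ) (i : ℕ) : ℤ :=
  ∑ S ∈ (Finset.Icc 1 (i - 1)).powerset,
    (∏ j ∈ Finset.Icc 1 i, catFactor n (insert i S) j) *
      (1 + ((2 : ℤ) ^ (n (i + 1) - 1) - 1) * catNest n (i + 2) (k - (i + 1)))

/-! The `i`-th witness, counted from `0`, is a cycle with initial state `0` and final state `m i -
1`. It has its own rotation letter and, unless it is the first one, its own reset letter; this makes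
`2 * k - 1` letters. The subset automaton of the concatenation stores one set of states per witness:
a singleton for the first, and `0` in component `i + 1` whenever component `i` contains its final
state.

The bound is a Myhill–Nerode argument. Every vector of sets satisfying `CatValid` is reachable, by
rotations alone (`CatValid.exists_catRun_eq`), and two distinct ones are separated by some word
(`exists_catRun_distinguish`), where resets are needed. So a DFA for the concatenation has at least
as many states as there are valid vectors (`card_le_of_accepts_eq`).

For the count, `n_1 T_2` is the number of vectors that begin with a singleton and have no nonempty
set after an empty one; `D` is what this condition discards from `n_1 2^(n_2 + ⋯ + n_k)`. Among the
remaining vectors, `E_i` counts those whose first violation of the rule "final state forces `0`"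
lies between the `i`-th and the next component. `mul_catNest_eq` is this sieve in algebraic form. -/

/-- The action of the letter `c` on the `i`-th automaton with state set `{0, …, m i - 1}`: the letter
`2 * i` is a cyclic shift, the letter `2 * i - 1` resets to `0`, all others are the identity. -/
def catMove (m : ℕ → ℕ) (i c q : ℕ) : ℕ :=
  if c = 2 * i then (if q + 1 = m i then 0 else q + 1) else if c + 1 = 2 * i then 0 else q

/-- Adds the initial state `0` to each of the first `k` components whose predecessor contains its
final state, and discards the other components. -/
def catClose (k : ℕ) (m : ℕ → ℕ) (g : ℕ → Finset ℕ) (i : ℕ) : Finset ℕ :=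
  if i < k then (if 0 < i ∧ m (i - 1) - 1 ∈ g (i - 1) then insert 0 (g i) else g i) else ∅

/-- One step of the subset automaton for the concatenation. -/
def catStep (k : ℕ) (m : ℕ → ℕ) (f : ℕ → Finset ℕ) (c : ℕ) : ℕ → Finset ℕ :=
  catClose k m fun i => (f i).image (catMove m i c)

/-- The run of the subset automaton on a word. -/
def catRun (k : ℕ) (m : ℕ → ℕ) (f : ℕ → Finset ℕ) (w : List (Fin (2 * k - 1))) : ℕ → Finset ℕ :=
  w.foldl (fun f c => catStep k m f c.val) f

/-- The initial state of the subset automaton. -/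
def catInit : ℕ → Finset ℕ := fun i => if i = 0 then {0} else ∅

/-- The combinatorial description of the reachable states of the subset automaton. -/
structure CatValid (k : ℕ) (m : ℕ → ℕ) (f : ℕ → Finset ℕ) : Prop where
  zero : ∃ q, f 0 = {q}
  lt : ∀ i, ∀ x ∈ f i, x < m i
  outside : ∀ i, k ≤ i → f i = ∅
  empty : ∀ i, f i = ∅ → f (i + 1) = ∅
  final : ∀ i, i + 1 < k → m i - 1 ∈ f i → 0 ∈ f (i + 1)

theorem mem_catStep {k : ℕ} {m : ℕ → ℕ} {f : ℕ → Finset ℕ} {c i x : ℕ} (hi : i < k) :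
    x ∈ catStep k m f c i ↔ (∃ y ∈ f i, catMove m i c y = x) ∨
      (x = 0 ∧ 0 < i ∧ ∃ y ∈ f (i - 1), catMove m (i - 1) c y = m (i - 1) - 1) := by
  unfold catStep catClose
  simp only [hi, if_true]
  split_ifs with h
  · simp only [Finset.mem_image] at h
    simp only [Finset.mem_insert, Finset.mem_image]
    constructor
    · rintro (h' | h')
      exacts [Or.inr ⟨h', h⟩, Or.inl h']
    · rintro (h' | ⟨h', -⟩)
      exacts [Or.inr h', Or.inl h']
  · simp only [Finset.mem_image] at h
    simp only [Finset.mem_image]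
    exact ⟨Or.inl, fun h' => h'.resolve_right fun h'' => h h''.2⟩

theorem catMove_lt {m : ℕ → ℕ} {i c q : ℕ} (h : q < m i) : catMove m i c q < m i := by
  unfold catMove
  split_ifs <;> omega

theorem catRun_append {k : ℕ} {m : ℕ → ℕ} (f : ℕ → Finset ℕ) (u v : List (Fin (2 * k - 1))) :
    catRun k m f (u ++ v) = catRun k m (catRun k m f u) v := by
  simp [catRun]

theorem catRun_singleton {k : ℕ} {m : ℕ → ℕ} (f : ℕ → Finset ℕ) (c : Fin (2 * k - 1)) :
    catRun k m f [c] = catStep k m f c.val := rfl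

theorem catClose_eq_self {k : ℕ} {m : ℕ → ℕ} {g : ℕ → Finset ℕ}
    (ho : ∀ i, k ≤ i → g i = ∅)
    (hf : ∀ i, i + 1 < k → m i - 1 ∈ g i → 0 ∈ g (i + 1)) : catClose k m g = g := by
  funext i
  unfold catClose
  split_ifs with h1 h2
  · obtain ⟨h2, h3⟩ := h2
    obtain ⟨j, rfl⟩ : ∃ j, i = j + 1 := ⟨i - 1, by omega⟩
    exact Finset.insert_eq_self.2 (hf j h1 h3)
  · rfl
  · exact (ho i (by omega)).symm

/-! ### Reachability -/

/-- A cyclic shift of the `i`-th component. -/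
theorem image_catMove_rotate {m : ℕ → ℕ} (f : ℕ → Finset ℕ) (i : ℕ) :
    (fun j => (f j).image (catMove m j (2 * i))) =
      Function.update f i ((f i).image (catMove m i (2 * i))) := by
  funext j
  by_cases h : j = i
  · subst h; simp
  · rw [Function.update_of_ne h]
    have : catMove m j (2 * i) = id := by
      funext q
      unfold catMove
      rw [if_neg (by omega), if_neg (by omega)]; rfl
    rw [this, Finset.image_id]

/-- The word shifting the `i`-th automaton, `i < k`. -/
theorem exists_catRun_rotate {k : ℕ} {m : ℕ → ℕ} {i : ℕ} (hi : i < k) (f : ℕ → Finset ℕ) :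
    ∃ w, catRun k m f w =
      catClose k m (Function.update f i ((f i).image (catMove m i (2 * i)))) := by
  refine ⟨[⟨2 * i, by omega⟩], ?_⟩
  rw [catRun_singleton, catStep, image_catMove_rotate]

/-- One full turn of the `i`-th cycle returns `{0}` to itself, and its passage through the final
state deposits `0` in component `i + 1`. Nothing else changes: the earlier components sit at `0`,
which is not final, and the later ones already satisfy the closure rule. -/
theorem exists_catRun_add_zero {k : ℕ} {m : ℕ → ℕ} (hm : ∀ i < k, 2 ≤ m i) {g : ℕ → Finset ℕ}
    (hg : CatValid k m g) {i : ℕ} (hi : i + 1 < k) (h0 : ∀ l ≤ i, g l = {0})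
    (hz : 0 ∈ g (i + 1)) :
    ∃ w, catRun k m (Function.update g (i + 1) ((g (i + 1)).erase 0)) w = g := by
  set g' := Function.update g (i + 1) ((g (i + 1)).erase 0) with hg'
  have hmi := hm i (by omega)
  have hrot : ∀ t, t + 1 < m i →
      ({t} : Finset ℕ).image (catMove m i (2 * i)) = {t + 1} := by
    intro t ht
    rw [Finset.image_singleton]
    unfold catMove
    rw [if_pos rfl, if_neg (by omega)]
  have hlast : ({m i - 1} : Finset ℕ).image (catMove m i (2 * i)) = {0} := by
    rw [Finset.image_singleton]
    unfold catMove
    rw [if_pos rfl, if_pos (by omega)]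
  have hfin : ∀ l < i, m l - 1 ∉ g l := by
    intro l hl
    have := hm l (by omega)
    rw [h0 l (by omega), Finset.mem_singleton]
    omega
  have key : ∀ t, t + 1 < m i → ∃ w, catRun k m g' w = Function.update g' i {t} := by
    intro t
    induction t with
    | zero =>
      intro _
      refine ⟨[], ?_⟩
      have : g' i = {0} := by rw [hg', Function.update_of_ne (by omega), h0 i le_rfl]
      rw [← this, Function.update_eq_self]; rfl
    | succ t ih =>
      intro ht
      obtain ⟨w, hw⟩ := ih (by omega)
      obtain ⟨v, hv⟩ := exists_catRun_rotate (m := m) (i := i) (by omega : i < k) (Function.update g' i {t})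
      refine ⟨w ++ v, ?_⟩
      rw [catRun_append, hw, hv, Function.update_self, Function.update_idem, hrot t (by omega)]
      apply catClose_eq_self
      · intro l hl
        rw [Function.update_of_ne (by omega), hg', Function.update_of_ne (by omega),
          hg.outside l hl]
      · intro l hl hl2
        rcases lt_trichotomy l i with h | h | h
        · rw [Function.update_of_ne (by omega), hg', Function.update_of_ne (by omega)] at hl2
          exact absurd hl2 (hfin l h)
        · subst h
          rw [Function.update_self, Finset.mem_singleton] at hl2
          omega
        · rw [Function.update_of_ne (by omega), hg', Function.update_of_ne (by omega)]
          apply hg.final l hl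
          rw [Function.update_of_ne (by omega), hg'] at hl2
          by_cases h' : l = i + 1
          · subst h'
            rw [Function.update_self] at hl2
            exact Finset.mem_of_mem_erase hl2
          · rwa [Function.update_of_ne h'] at hl2
  obtain ⟨w, hw⟩ := key (m i - 2) (by omega)
  obtain ⟨v, hv⟩ := exists_catRun_rotate (m := m) (i := i) (by omega : i < k)
    (Function.update g' i {m i - 2})
  have h1 : catRun k m g' (w ++ v) = Function.update g i {m i - 1} := by
    rw [catRun_append, hw, hv, Function.update_self, Function.update_idem, hrot _ (by omega),
      show m i - 2 + 1 = m i - 1 by omega]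
    funext l
    unfold catClose
    by_cases hl : l < k
    · rw [if_pos hl]
      by_cases hl1 : l = i + 1
      · subst hl1
        rw [if_pos (by simp), Function.update_of_ne (by omega), Function.update_of_ne (by omega),
          hg', Function.update_self, Finset.insert_erase hz]
      · by_cases hli : l = i
        · subst hli
          rw [Function.update_self, Function.update_self, if_neg]
          rintro ⟨hl0, hl2⟩
          rw [Function.update_of_ne (by omega), hg', Function.update_of_ne (by omega)] at hl2
          exact hfin (l - 1) (by omega) hl2
        · have hgl : Function.update g' i {m i - 1} l = g l := by
            rw [Function.update_of_ne hli, hg', Function.update_of_ne hl1]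
          rw [hgl, Function.update_of_ne hli]
          split_ifs with h
          · obtain ⟨hl0, h⟩ := h
            rw [Finset.insert_eq_self]
            rw [Function.update_of_ne (by omega), hg'] at h
            obtain ⟨j, rfl⟩ : ∃ j, l = j + 1 := ⟨l - 1, by omega⟩
            apply hg.final j hl
            rw [Nat.add_sub_cancel] at h
            by_cases h' : j = i + 1
            · subst h'
              rw [Function.update_self] at h
              exact Finset.mem_of_mem_erase h
            · rwa [Function.update_of_ne h'] at h
          · rfl
    · rw [if_neg hl, Function.update_of_ne (by omega), hg.outside l (by omega)]
  obtain ⟨u, hu⟩ := exists_catRun_rotate (m := m) (i := i) (by omega : i < k)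
    (Function.update g i {m i - 1})
  refine ⟨w ++ v ++ u, ?_⟩
  rw [catRun_append, h1, hu, Function.update_self, Function.update_idem, hlast, ← h0 i le_rfl,
    Function.update_eq_self]
  exact catClose_eq_self hg.outside hg.final

theorem exists_catRun_shift {k : ℕ} {m : ℕ → ℕ} {g : ℕ → Finset ℕ}
    (hg : CatValid k m g) {i : ℕ} (hi : i < k) (hz : 0 ∉ g i) :
    ∃ w, catRun k m (Function.update g i ((g i).image (· - 1))) w = g := by
  obtain ⟨w, hw⟩ := exists_catRun_rotate (m := m) hi (Function.update g i ((g i).image (· - 1)))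
  refine ⟨w, ?_⟩
  rw [hw, Function.update_self, Function.update_idem, Finset.image_image]
  have : (g i).image (catMove m i (2 * i) ∘ (· - 1)) = g i := by
    conv_rhs => rw [← Finset.image_id (s := g i)]
    apply Finset.image_congr
    intro x hx
    have h1 : x < m i := hg.lt i x hx
    have h2 : x ≠ 0 := by rintro rfl; exact hz hx
    simp only [Function.comp, catMove, if_true, id]
    rw [if_neg (by omega)]
    omega
  rw [this, Function.update_eq_self]
  exact catClose_eq_self hg.outside hg.final

/-- Moving down by one takes the final state out of component `i`, so no new demand falls on
component `i + 1`. Component `i` itself lacks `0`, so by validity its predecessor does not contain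
its final state. -/
theorem CatValid.shift {k : ℕ} {m : ℕ → ℕ} {g : ℕ → Finset ℕ}
    (hg : CatValid k m g) {i : ℕ} (hi : i < k) (hz : 0 ∉ g i) :
    CatValid k m (Function.update g i ((g i).image (· - 1))) := by
  have hne : ∀ l, Function.update g i ((g i).image (· - 1)) l = ∅ ↔ g l = ∅ := by
    intro l
    by_cases h : l = i
    · subst h; simp
    · rw [Function.update_of_ne h]
  refine ⟨?_, ?_, ?_, ?_, ?_⟩
  · obtain ⟨q, hq⟩ := hg.zero
    by_cases h : 0 = i
    · subst h
      exact ⟨q - 1, by simp [hq]⟩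
    · exact ⟨q, by rw [Function.update_of_ne h, hq]⟩
  · intro l x hx
    by_cases h : l = i
    · subst h
      rw [Function.update_self, Finset.mem_image] at hx
      obtain ⟨y, hy, rfl⟩ := hx
      have := hg.lt l y hy
      omega
    · rw [Function.update_of_ne h] at hx
      exact hg.lt l x hx
  · intro l hl
    rw [hne, hg.outside l hl]
  · intro l hl
    rw [hne] at hl ⊢
    exact hg.empty l hl
  · intro l hl hl2
    by_cases h : l = i
    · subst h
      rw [Function.update_self, Finset.mem_image] at hl2
      obtain ⟨y, hy, hy2⟩ := hl2
      have := hg.lt l y hy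
      have h2 : y ≠ 0 := by rintro rfl; exact hz hy
      omega
    · rw [Function.update_of_ne h] at hl2
      have h3 := hg.final l hl hl2
      by_cases h' : l + 1 = i
      · subst h'; exact absurd h3 hz
      · rwa [Function.update_of_ne h']

/-- The hypothesis `he` prevents the erasure from leaving an empty component in front of a nonempty
one. -/
theorem CatValid.erase_zero {k : ℕ} {m : ℕ → ℕ} (hm : ∀ i < k, 2 ≤ m i) {g : ℕ → Finset ℕ}
    (hg : CatValid k m g) {i : ℕ} (hi : i + 1 < k) (h0 : g i = {0})
    (he : g (i + 1) = {0} → g (i + 2) = ∅) :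
    CatValid k m (Function.update g (i + 1) ((g (i + 1)).erase 0)) := by
  have hsub : ∀ l, Function.update g (i + 1) ((g (i + 1)).erase 0) l ⊆ g l := by
    intro l
    by_cases h : l = i + 1
    · subst h
      rw [Function.update_self]
      exact Finset.erase_subset _ _
    · rw [Function.update_of_ne h]
  refine ⟨?_, fun l x hx => hg.lt l x (hsub l hx),
    fun l hl => Finset.subset_empty.1 (hg.outside l hl ▸ hsub l), ?_, ?_⟩
  · rw [Function.update_of_ne (by omega)]
    exact hg.zero
  · intro l hl
    by_cases h : l = i + 1
    · subst h
      rw [Function.update_self, Finset.erase_eq_empty_iff] at hl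
      rw [Function.update_of_ne (by omega)]
      rcases hl with hl | hl
      · exact hg.empty _ hl
      · exact he hl
    · rw [Function.update_of_ne h] at hl
      exact Finset.subset_empty.1 (hg.empty l hl ▸ hsub (l + 1))
  · intro l hl hl2
    have h3 := hg.final l hl (hsub l hl2)
    by_cases h : l = i
    · subst h
      have := hsub _ hl2
      rw [h0, Finset.mem_singleton] at this
      have := hm l (by omega)
      omega
    · rwa [Function.update_of_ne (by omega)]

/-- Every valid state is reachable. -/
theorem CatValid.exists_catRun_eq {k : ℕ} {m : ℕ → ℕ} (hm : ∀ i < k, 2 ≤ m i)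
    {g : ℕ → Finset ℕ} (hg : CatValid k m g) : ∃ w, catRun k m catInit w = g := by
  -- The weight uses `x + 1` rather than `x` so that deleting the element `0` also lowers it.
  obtain ⟨N, hN⟩ : ∃ N, ∑ i ∈ Finset.range k, ∑ x ∈ g i, (x + 1) = N := ⟨_, rfl⟩
  induction N using Nat.strong_induction_on generalizing g with
  | _ N ih =>
  have step : ∀ (i : ℕ) (X : Finset ℕ), i < k → ∑ x ∈ X, (x + 1) < ∑ x ∈ g i, (x + 1) →
      CatValid k m (Function.update g i X) → (∃ w, catRun k m (Function.update g i X) w = g) →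
      ∃ w, catRun k m catInit w = g := by
    rintro i X hi hX hv ⟨w, hw⟩
    obtain ⟨u, hu⟩ := ih _ (by
      rw [← hN]
      apply Finset.sum_lt_sum (f := fun l => ∑ x ∈ Function.update g i X l, (x + 1))
      · intro l _
        by_cases h : l = i
        · subst h; rw [Function.update_self]; exact hX.le
        · rw [Function.update_of_ne h]
      · exact ⟨i, Finset.mem_range.2 hi, by rw [Function.update_self]; exact hX⟩) hv rfl
    exact ⟨u ++ w, by rw [catRun_append, hu, hw]⟩
  by_cases hA : ∃ i, (g i).Nonempty ∧ 0 ∉ g i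
  · obtain ⟨i, hne, hz⟩ := hA
    have hi : i < k := by
      by_contra h
      rw [hg.outside i (by omega)] at hne
      exact Finset.not_nonempty_empty hne
    refine step i _ hi ?_ (hg.shift hi hz) (exists_catRun_shift hg hi hz)
    rw [Finset.sum_image]
    · apply Finset.sum_lt_sum_of_nonempty hne
      intro x hx
      have h2 : x ≠ 0 := by rintro rfl; exact hz hx
      omega
    · intro x hx y hy hxy
      have h2 : x ≠ 0 := by rintro rfl; exact hz hx
      have h3 : y ≠ 0 := by rintro rfl; exact hz hy
      simp only at hxy
      omega
  · push Not at hA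
    have h00 : g 0 = {0} := by
      obtain ⟨q, hq⟩ := hg.zero
      have := hA 0 (by simp [hq])
      rw [hq, Finset.mem_singleton] at this
      rw [hq, this]
    have hex : ∃ i, g (i + 1) ≠ {0} := ⟨k, by rw [hg.outside (k + 1) (by omega)]; simp⟩
    classical
    -- Component `j + 1` is the first one different from `{0}`. If it is nonempty, its `0` can be
    -- erased; if it is empty, component `j` is the last nonempty one and is emptied instead, unless
    -- `j = 0`, which is the initial state.
    set j := Nat.find hex with hj
    have hj1 : g (j + 1) ≠ {0} := Nat.find_spec hex
    have hj2 : ∀ l ≤ j, g l = {0} := by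
      intro l hl
      rcases l with _ | l
      · exact h00
      · exact not_not.1 (Nat.find_min hex (by omega : l < j))
    have fin : ∀ i, i + 1 < k → (∀ l ≤ i, g l = {0}) → 0 ∈ g (i + 1) →
        (g (i + 1) = {0} → g (i + 2) = ∅) → ∃ w, catRun k m catInit w = g := by
      intro i hi h0 hz he
      refine step (i + 1) _ hi ?_ (hg.erase_zero hm hi (h0 i le_rfl) he)
        (exists_catRun_add_zero hm hg hi h0 hz)
      rw [← Finset.add_sum_erase _ _ hz]
      omega
    by_cases hje : g (j + 1) = ∅
    · rcases hj0 : j with _ | i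
      · refine ⟨[], ?_⟩
        have hemp : ∀ l, g (l + 1) = ∅ := by
          intro l
          induction l with
          | zero => rw [hj0] at hje; exact hje
          | succ l ih => exact hg.empty _ ih
        funext l
        rcases l with _ | l
        · simp [catRun, catInit, h00]
        · simp [catRun, catInit, hemp l]
      · rw [hj0] at hje hj2
        have hik : i + 1 < k := by
          by_contra h
          have := hg.outside (i + 1) (by omega)
          rw [hj2 (i + 1) le_rfl] at this
          simp at this
        exact fin i hik (fun l hl => hj2 l (by omega)) (by rw [hj2 (i + 1) le_rfl]; simp)
          fun _ => hje
    · have hne := Finset.nonempty_iff_ne_empty.2 hje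
      have hjk : j + 1 < k := by
        by_contra h
        exact hje (hg.outside (j + 1) (by omega))
      exact fin j hjk hj2 (hA _ hne) fun h => absurd h hj1

/-! ### Distinguishability -/

/-- Two states of the subset automaton that differ in some component can be told apart. -/
theorem exists_catRun_distinguish {k : ℕ} {m : ℕ → ℕ} (hm : ∀ i < k, 2 ≤ m i) (d : ℕ) :
    ∀ (i s : ℕ) (f g : ℕ → Finset ℕ), i + d + 1 = k → s < m i → s ∈ f i → s ∉ g i →
      ∃ w, m (k - 1) - 1 ∈ catRun k m f w (k - 1) ∧ m (k - 1) - 1 ∉ catRun k m g w (k - 1) := by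
  have shift : ∀ (t i s : ℕ) (f g : ℕ → Finset ℕ), i < k → s + t + 1 = m i → s ∈ f i → s ∉ g i →
      ∃ w, m i - 1 ∈ catRun k m f w i ∧ m i - 1 ∉ catRun k m g w i := by
    intro t
    induction t with
    | zero =>
      intro i s f g hi hs hf hg
      refine ⟨[], ?_⟩
      rw [← hs]
      exact ⟨hf, hg⟩
    | succ t ih =>
      intro i s f g hi hs hf hg
      obtain ⟨w, hw1, hw2⟩ := ih i (s + 1) (catStep k m f (2 * i)) (catStep k m g (2 * i)) hi
        (by omega)
        ((mem_catStep hi).2 (Or.inl ⟨s, hf, by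
          unfold catMove; rw [if_pos rfl, if_neg (by omega)]⟩))
        (by
          rw [mem_catStep hi]
          rintro (⟨y, hy, hy2⟩ | ⟨h, -⟩)
          · unfold catMove at hy2
            rw [if_pos rfl] at hy2
            split_ifs at hy2
            obtain rfl : y = s := by omega
            exact hg hy
          · omega)
      exact ⟨[⟨2 * i, by omega⟩] ++ w, by rwa [catRun_append, catRun_singleton],
        by rwa [catRun_append, catRun_singleton]⟩
  induction d with
  | zero =>
    intro i s f g hi hs hf hg
    obtain rfl : i = k - 1 := by omega
    exact shift (m (k - 1) - 1 - s) _ s f g (by omega) (by omega) hf hg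
  | succ d ih =>
    intro i s f g hi hs hf hg
    have hik : i < k := by omega
    have hik1 : i + 1 < k := by omega
    have hmi := hm i hik
    have hmi1 := hm (i + 1) hik1
    obtain ⟨w, hw1, hw2⟩ := shift (m i - 1 - s) i s f g hik (by omega) hf hg
    set f1 := catRun k m f w
    set g1 := catRun k m g w
    have hid : ∀ c x, c ≠ 2 * i → c + 1 ≠ 2 * i → catMove m i c x = x := by
      intro c x h1 h2
      unfold catMove
      rw [if_neg h1, if_neg h2]
    have keep : ∀ (h : ℕ → Finset ℕ) c, c ≠ 2 * i → c + 1 ≠ 2 * i →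
        (m i - 1 ∈ catStep k m h c i ↔ m i - 1 ∈ h i) := by
      intro h c h1 h2
      rw [mem_catStep hik]
      constructor
      · rintro (⟨y, hy, hy2⟩ | ⟨h, -⟩)
        · rw [hid c y h1 h2] at hy2
          rwa [← hy2]
        · omega
      · intro h'
        exact Or.inl ⟨_, h', hid c _ h1 h2⟩
    have hzero : ∀ h c, c ≠ 2 * i → c + 1 ≠ 2 * i → m i - 1 ∈ h i →
        0 ∈ catStep k m h c (i + 1) := by
      intro h c h1 h2 hh
      rw [mem_catStep hik1]
      exact Or.inr ⟨rfl, by omega, m i - 1, hh, hid c _ h1 h2⟩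
    -- The letter `2 * i + 1` resets automaton `i + 1`, leaving at most `0` in that component. The
    -- rotation that follows moves this `0` to `1`, and only on the side of `f` does the final state
    -- of component `i` put a new `0` there.
    set f2 := catStep k m f1 (2 * i + 1)
    set g2 := catStep k m g1 (2 * i + 1)
    have hf2 : m i - 1 ∈ f2 i := (keep f1 _ (by omega) (by omega)).2 hw1
    have hg2 : m i - 1 ∉ g2 i := fun h => hw2 ((keep g1 _ (by omega) (by omega)).1 h)
    have hg2z : ∀ x ∈ g2 (i + 1), x = 0 := by
      intro x hx
      rcases (mem_catStep hik1).1 hx with ⟨y, -, rfl⟩ | ⟨h, -⟩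
      · unfold catMove
        rw [if_neg (by omega), if_pos (by omega)]
      · exact h
    obtain ⟨v, hv1, hv2⟩ := ih (i + 1) 0 (catStep k m f2 (2 * (i + 1)))
      (catStep k m g2 (2 * (i + 1))) (by omega) (by omega)
      (hzero _ _ (by omega) (by omega) hf2) (by
        rw [mem_catStep hik1]
        rintro (⟨y, hy, hy2⟩ | ⟨-, -, y, hy, hy2⟩)
        · rw [hg2z y hy] at hy2
          unfold catMove at hy2
          rw [if_pos rfl, if_neg (by omega)] at hy2
          omega
        · rw [Nat.add_sub_cancel, hid _ _ (by omega) (by omega)] at hy2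
          rw [Nat.add_sub_cancel, hy2] at hy
          exact hg2 hy)
    refine ⟨w ++ ([⟨2 * i + 1, by omega⟩] ++ ([⟨2 * (i + 1), by omega⟩] ++ v)), ?_, ?_⟩
    · rwa [catRun_append, catRun_append, catRun_singleton, catRun_append, catRun_singleton]
    · rwa [catRun_append, catRun_append, catRun_singleton, catRun_append, catRun_singleton]

/-! ### Languages, witness DFAs and the Myhill–Nerode bound -/

/-- The language of the `i`-th witness automaton. -/
def catLang (K : ℕ) (m : ℕ → ℕ) (i : ℕ) : Language (Fin K) :=
  {v | v.foldl (fun q c => catMove m i c.val q) 0 = m i - 1}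

/-- The concatenation of the first `j` witness languages. -/
def catLangProd (K : ℕ) (m : ℕ → ℕ) : ℕ → Language (Fin K)
  | 0 => 1
  | j + 1 => catLangProd K m j * catLang K m j

theorem mem_catLang {K : ℕ} {m : ℕ → ℕ} {i : ℕ} {v : List (Fin K)} :
    v ∈ catLang K m i ↔ v.foldl (fun q c => catMove m i c.val q) 0 = m i - 1 := Iff.rfl

theorem mem_catLangProd_succ {K : ℕ} {m : ℕ → ℕ} {j : ℕ} {w : List (Fin K)} :
    w ∈ catLangProd K m (j + 1) ↔ ∃ u v, u ∈ catLangProd K m j ∧ u ++ v = w ∧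
      v.foldl (fun q c => catMove m j c.val q) 0 = m j - 1 := by
  rw [catLangProd, Language.mem_mul]
  constructor
  · rintro ⟨u, hu, v, hv, h⟩
    exact ⟨u, v, hu, h, hv⟩
  · rintro ⟨u, v, hu, h, hv⟩
    exact ⟨u, hu, v, hv, h⟩

/-- The `j`-th component of the run consists of the states in which the `j`-th automaton can be
after a factorization of the word. -/
theorem mem_catRun_catInit {k : ℕ} {m : ℕ → ℕ} (hm : ∀ i < k, 2 ≤ m i)
    (w : List (Fin (2 * k - 1))) : ∀ j < k, ∀ x, x ∈ catRun k m catInit w j ↔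
      ∃ u v, u ∈ catLangProd (2 * k - 1) m j ∧ u ++ v = w ∧
        v.foldl (fun q c => catMove m j c.val q) 0 = x := by
  induction w using List.reverseRecOn with
  | nil =>
    intro j hj x
    have h1 : x ∈ catRun k m catInit [] j ↔ j = 0 ∧ x = 0 := by
      change x ∈ (if j = 0 then ({0} : Finset ℕ) else ∅) ↔ _
      split_ifs with h <;> simp [h]
    rw [h1]
    constructor
    · rintro ⟨rfl, rfl⟩
      exact ⟨[], [], Language.nil_mem_one, rfl, rfl⟩
    · rintro ⟨u, v, hu, huv, hx⟩
      obtain ⟨rfl, rfl⟩ := List.append_eq_nil_iff.1 huv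
      refine ⟨?_, hx.symm⟩
      rcases j with _ | j
      · rfl
      · obtain ⟨u, v, -, huv, hv⟩ := mem_catLangProd_succ.1 hu
        obtain ⟨rfl, rfl⟩ := List.append_eq_nil_iff.1 huv
        have := hm j (by omega)
        rw [List.foldl_nil] at hv
        omega
  | append_singleton w c ih =>
    -- No witness accepts the empty word, because `m l - 1 ≠ 0`. So the last factor is nonempty and
    -- `c` can be split off from it.
    have hlast : ∀ l < k, (w ++ [c] ∈ catLangProd (2 * k - 1) m (l + 1) ↔
        ∃ y ∈ catRun k m catInit w l, catMove m l c y = m l - 1) := by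
      intro l hl
      rw [mem_catLangProd_succ]
      constructor
      · rintro ⟨u, v, hu, huv, hv⟩
        rcases List.eq_nil_or_concat' v with rfl | ⟨v, d, rfl⟩
        · have := hm l hl
          rw [List.foldl_nil] at hv
          omega
        · rw [← List.append_assoc] at huv
          obtain ⟨huv', hd⟩ := List.append_inj' huv rfl
          obtain rfl : d = c := by simpa using hd
          rw [List.foldl_append] at hv
          exact ⟨_, (ih l hl _).2 ⟨u, v, hu, huv', rfl⟩, hv⟩
      · rintro ⟨y, hy, hy2⟩
        obtain ⟨u, v, hu, huv, hv⟩ := (ih l hl y).1 hy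
        refine ⟨u, v ++ [c], hu, by rw [← List.append_assoc, huv], ?_⟩
        rw [List.foldl_append, hv]
        exact hy2
    intro j hj x
    rw [catRun_append, catRun_singleton, mem_catStep hj]
    constructor
    · rintro (⟨y, hy, rfl⟩ | ⟨rfl, h0, hy⟩)
      · obtain ⟨u, v, hu, huv, hv⟩ := (ih j hj y).1 hy
        refine ⟨u, v ++ [c], hu, by rw [← List.append_assoc, huv], ?_⟩
        rw [List.foldl_append, hv]
        rfl
      · obtain ⟨l, rfl⟩ : ∃ l, j = l + 1 := ⟨j - 1, by omega⟩
        exact ⟨w ++ [c], [], (hlast l (by omega)).2 hy, List.append_nil _, rfl⟩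
    · rintro ⟨u, v, hu, huv, hv⟩
      rcases List.eq_nil_or_concat' v with rfl | ⟨v, d, rfl⟩
      · rw [List.append_nil] at huv
        subst huv
        rcases j with _ | j
        · have : w ++ [c] = [] := hu
          simp at this
        · exact Or.inr ⟨hv.symm, by omega, (hlast j (by omega)).1 hu⟩
      · rw [← List.append_assoc] at huv
        obtain ⟨huv', hd⟩ := List.append_inj' huv rfl
        obtain rfl : d = c := by simpa using hd
        rw [List.foldl_append] at hv
        exact Or.inl ⟨_, (ih j hj _).2 ⟨u, v, hu, huv', rfl⟩, hv⟩

theorem mem_catLangProd_iff {k : ℕ} (hk : 1 ≤ k) {m : ℕ → ℕ} (hm : ∀ i < k, 2 ≤ m i)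
    (w : List (Fin (2 * k - 1))) : w ∈ catLangProd (2 * k - 1) m k ↔
      m (k - 1) - 1 ∈ catRun k m catInit w (k - 1) := by
  rw [mem_catRun_catInit hm w (k - 1) (by omega)]
  obtain ⟨j, rfl⟩ : ∃ j, k = j + 1 := ⟨k - 1, by omega⟩
  exact mem_catLangProd_succ

theorem prod_ofFn_catLang (K : ℕ) (m : ℕ → ℕ) (j : ℕ) :
    (List.ofFn fun i : Fin j => catLang K m i).prod = catLangProd K m j := by
  induction j with
  | zero => rfl
  | succ j ih =>
    rw [List.ofFn_succ_last, List.prod_append, List.prod_singleton]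
    exact congrArg (· * catLang K m j) ih

/-- The `i`-th witness automaton. -/
def catDFA (K : ℕ) (m : ℕ → ℕ) (i : ℕ) (h : 0 < m i) : DFA (Fin K) (Fin (m i)) where
  step q c := ⟨catMove m i c q, catMove_lt q.2⟩
  start := ⟨0, h⟩
  accept := {q | q.val = m i - 1}

theorem accepts_catDFA (K : ℕ) (m : ℕ → ℕ) (i : ℕ) (h : 0 < m i) :
    (catDFA K m i h).accepts = catLang K m i := by
  have key : ∀ v : List (Fin K), ((catDFA K m i h).eval v).val =
      v.foldl (fun q c => catMove m i c.val q) 0 := by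
    intro v
    induction v using List.reverseRecOn with
    | nil => rfl
    | append_singleton v c ih =>
      rw [DFA.eval_append_singleton, List.foldl_append, ← ih]
      rfl
  ext v
  rw [DFA.mem_accepts, mem_catLang, ← key]
  rfl

/-- A DFA for the concatenation of the witness languages has at least as many states as there are
valid states of the subset automaton. -/
theorem card_le_of_accepts_eq {k : ℕ} (hk : 1 ≤ k) {m : ℕ → ℕ} (hm : ∀ i < k, 2 ≤ m i)
    {σ : Type*} [Fintype σ] (B : DFA (Fin (2 * k - 1)) σ)
    (hB : B.accepts = catLangProd (2 * k - 1) m k) (V : Finset (ℕ → Finset ℕ))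
    (hV : ∀ f ∈ V, CatValid k m f) : V.card ≤ Fintype.card σ := by
  have hr : ∀ f : ℕ → Finset ℕ, ∃ w, f ∈ V → catRun k m catInit w = f := by
    intro f
    by_cases hf : f ∈ V
    · obtain ⟨w, hw⟩ := (hV f hf).exists_catRun_eq hm
      exact ⟨w, fun _ => hw⟩
    · exact ⟨[], fun h => absurd h hf⟩
  choose w hw using hr
  have hacc : ∀ f ∈ V, ∀ z, B.evalFrom (B.eval (w f)) z ∈ B.accept ↔
      m (k - 1) - 1 ∈ catRun k m f z (k - 1) := by
    intro f hf z
    rw [DFA.eval, ← DFA.evalFrom_of_append]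
    change w f ++ z ∈ B.accepts ↔ _
    rw [hB, mem_catLangProd_iff hk hm, catRun_append, hw f hf]
  have hsub : ∀ f ∈ V, ∀ g ∈ V, B.eval (w f) = B.eval (w g) → ∀ i, f i ⊆ g i := by
    intro f hf g hg hfg i s hs
    by_contra hs'
    have hik : i < k := by
      by_contra h
      rw [(hV f hf).outside i (by omega)] at hs
      simp at hs
    obtain ⟨z, hz1, hz2⟩ := exists_catRun_distinguish hm (k - 1 - i) i s f g (by omega)
      ((hV f hf).lt i s hs) hs hs'
    rw [← hacc f hf, hfg, hacc g hg] at hz1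
    exact hz2 hz1
  rw [← Finset.card_univ]
  refine Finset.card_le_card_of_injOn (fun f => B.eval (w f)) (fun _ _ => Finset.mem_univ _) ?_
  intro f hf g hg hfg
  funext i
  exact (hsub f hf g hg hfg i).antisymm (hsub g hg f hf hfg.symm i)

/-! ### Counting the valid states -/

/-- The functions that arise from those in `F` by putting a set from `C` into position `i`. -/
noncomputable def catExtend (F : Finset (ℕ → Finset ℕ)) (i : ℕ) (C : Finset (Finset ℕ)) :
    Finset (ℕ → Finset ℕ) :=
  open Classical in (F ×ˢ C).image fun p => Function.update p.1 i p.2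

theorem mem_catExtend {F : Finset (ℕ → Finset ℕ)} {i : ℕ} {C : Finset (Finset ℕ)}
    {f : ℕ → Finset ℕ} :
    f ∈ catExtend F i C ↔ ∃ g ∈ F, ∃ X ∈ C, Function.update g i X = f := by
  classical
  simp [catExtend, and_assoc]

theorem card_catExtend {F : Finset (ℕ → Finset ℕ)} {i : ℕ} (C : Finset (Finset ℕ))
    (hF : ∀ f ∈ F, f i = ∅) : (catExtend F i C).card = F.card * C.card := by
  classical
  rw [catExtend, ← Finset.card_product]
  convert Finset.card_image_of_injOn ?_
  rintro ⟨f, X⟩ hf ⟨g, Y⟩ hg h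
  rw [Finset.mem_coe, Finset.mem_product] at hf hg
  simp only at h hf hg
  have h1 : X = Y := by simpa using congrFun h i
  have h2 : f = g := by
    have := congrArg (fun u => Function.update u i ∅) h
    simp only [Function.update_idem] at this
    rwa [← hF f hf.1, Function.update_eq_self, hF f hf.1, ← hF g hg.1,
      Function.update_eq_self] at this
  rw [h1, h2]

/-- The valid prefixes of length `a + 1` all of whose components are nonempty: those whose last
component contains the final state, and those whose last component does not. -/
noncomputable def catPrefix (m : ℕ → ℕ) : ℕ → Finset (ℕ → Finset ℕ) × Finset (ℕ → Finset ℕ)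
  | 0 => (catExtend {fun _ => ∅} 0 {{m 0 - 1}},
      catExtend {fun _ => ∅} 0 ((Finset.range (m 0 - 1)).image fun q => {q}))
  | a + 1 =>
    open Classical in
    (catExtend (catPrefix m a).1 (a + 1)
        (Finset.Icc {0, m (a + 1) - 1} (Finset.range (m (a + 1)))) ∪
      catExtend (catPrefix m a).2 (a + 1)
        (Finset.Icc {m (a + 1) - 1} (Finset.range (m (a + 1)))),
    catExtend (catPrefix m a).1 (a + 1)
        (Finset.Icc {0} (Finset.range (m (a + 1) - 1))) ∪
      catExtend (catPrefix m a).2 (a + 1)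
        ((Finset.range (m (a + 1) - 1)).powerset.erase ∅))

/-- The properties shared by the elements of both parts of `catPrefix m a`. -/
structure CatPrefixValid (m : ℕ → ℕ) (a : ℕ) (f : ℕ → Finset ℕ) : Prop where
  zero : ∃ q, f 0 = {q}
  lt : ∀ i, ∀ x ∈ f i, x < m i
  outside : ∀ i, a < i → f i = ∅
  nonempty : ∀ i ≤ a, f i ≠ ∅
  final : ∀ i < a, m i - 1 ∈ f i → 0 ∈ f (i + 1)

theorem CatPrefixValid.update {m : ℕ → ℕ} {a : ℕ} {f : ℕ → Finset ℕ} (hf : CatPrefixValid m a f)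
    {X : Finset ℕ} (hX : X ⊆ Finset.range (m (a + 1))) (hne : X ≠ ∅)
    (h : m a - 1 ∈ f a → 0 ∈ X) : CatPrefixValid m (a + 1) (Function.update f (a + 1) X) := by
  refine ⟨?_, ?_, ?_, ?_, ?_⟩
  · rw [Function.update_of_ne (by omega)]
    exact hf.zero
  · intro i x hx
    by_cases hi : i = a + 1
    · subst hi
      rw [Function.update_self] at hx
      exact Finset.mem_range.1 (hX hx)
    · rw [Function.update_of_ne hi] at hx
      exact hf.lt i x hx
  · intro i hi
    rw [Function.update_of_ne (by omega)]
    exact hf.outside i (by omega)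
  · intro i hi
    by_cases hi' : i = a + 1
    · subst hi'
      rwa [Function.update_self]
    · rw [Function.update_of_ne hi']
      exact hf.nonempty i (by omega)
  · intro i hi hi2
    rw [Function.update_of_ne (by omega)] at hi2
    by_cases hi' : i = a
    · subst hi'
      rw [Function.update_self]
      exact h hi2
    · rw [Function.update_of_ne (by omega)]
      exact hf.final i (by omega) hi2

theorem catPrefixValid_of_mem {m : ℕ → ℕ} {a : ℕ} (hm : ∀ i ≤ a, 2 ≤ m i) {f : ℕ → Finset ℕ} :
    (f ∈ (catPrefix m a).1 → CatPrefixValid m a f ∧ m a - 1 ∈ f a) ∧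
    (f ∈ (catPrefix m a).2 → CatPrefixValid m a f ∧ m a - 1 ∉ f a) := by
  classical
  induction a generalizing f with
  | zero =>
    have h0 := hm 0 le_rfl
    have base : ∀ q < m 0, CatPrefixValid m 0 (Function.update (fun _ => ∅) 0 {q}) := by
      intro q hq
      refine ⟨⟨q, by simp⟩, ?_, ?_, ?_, ?_⟩
      · intro i x hx
        by_cases hi : i = 0
        · subst hi
          rw [Function.update_self, Finset.mem_singleton] at hx
          omega
        · rw [Function.update_of_ne hi] at hx
          simp at hx
      · intro i hi
        rw [Function.update_of_ne (by omega)]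
      · intro i hi
        obtain rfl : i = 0 := by omega
        simp
      · intro i hi
        omega
    constructor
    · intro h
      obtain ⟨g, hg, X, hX, rfl⟩ := mem_catExtend.1 h
      rw [Finset.mem_singleton] at hg hX
      subst hg hX
      exact ⟨base _ (by omega), by simp⟩
    · intro h
      obtain ⟨g, hg, X, hX, rfl⟩ := mem_catExtend.1 h
      rw [Finset.mem_singleton] at hg
      obtain ⟨q, hq, rfl⟩ := Finset.mem_image.1 hX
      rw [Finset.mem_range] at hq
      subst hg
      refine ⟨base _ (by omega), ?_⟩
      rw [Function.update_self, Finset.mem_singleton]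
      omega
  | succ a ih =>
    have ha := hm (a + 1) le_rfl
    have ih1 := fun f => (ih (fun i hi => hm i (by omega)) (f := f)).1
    have ih2 := fun f => (ih (fun i hi => hm i (by omega)) (f := f)).2
    have hsub : Finset.range (m (a + 1) - 1) ⊆ Finset.range (m (a + 1)) :=
      Finset.range_subset_range.2 (by omega)
    constructor
    · intro h
      rcases Finset.mem_union.1 h with h | h <;> obtain ⟨g, hg, X, hX, rfl⟩ := mem_catExtend.1 h <;>
        rw [Finset.mem_Icc] at hX <;> rw [Function.update_self]
      · have hl : m (a + 1) - 1 ∈ X := hX.1 (by simp)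
        exact ⟨(ih1 g hg).1.update hX.2 (Finset.ne_empty_of_mem hl) fun _ => hX.1 (by simp), hl⟩
      · have hl : m (a + 1) - 1 ∈ X := hX.1 (by simp)
        exact ⟨(ih2 g hg).1.update hX.2 (Finset.ne_empty_of_mem hl)
          fun h => absurd h (ih2 g hg).2, hl⟩
    · intro h
      have hnot : ∀ X ⊆ Finset.range (m (a + 1) - 1), m (a + 1) - 1 ∉ X := by
        intro X hX h
        simpa using hX h
      rcases Finset.mem_union.1 h with h | h <;> obtain ⟨g, hg, X, hX, rfl⟩ := mem_catExtend.1 h <;>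
        rw [Function.update_self]
      · rw [Finset.mem_Icc] at hX
        have hl : 0 ∈ X := hX.1 (by simp)
        exact ⟨(ih1 g hg).1.update (subset_trans hX.2 hsub) (Finset.ne_empty_of_mem hl)
          fun _ => hl, hnot X hX.2⟩
      · rw [Finset.mem_erase, Finset.mem_powerset] at hX
        exact ⟨(ih2 g hg).1.update (subset_trans hX.2 hsub) hX.1
          fun h => absurd h (ih2 g hg).2, hnot X hX.2⟩

theorem card_catPrefix_zero (m : ℕ → ℕ) :
    (catPrefix m 0).1.card = 1 ∧ (catPrefix m 0).2.card = m 0 - 1 := by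
  constructor
  · rw [catPrefix, card_catExtend _ (by simp)]
    simp
  · rw [catPrefix, card_catExtend _ (by simp), Finset.card_image_of_injective _
      Finset.singleton_injective]
    simp

/-- After a component with its final state, membership of both `0` and `m (a + 1) - 1` is
prescribed, which leaves `m (a + 1) - 2` free elements. Otherwise only the latter is prescribed, and
the empty set must be excluded when the final state is absent. The unions are disjoint because
component `a` reveals which part a prefix extends. -/
theorem card_catPrefix_succ {m : ℕ → ℕ} {a : ℕ} (hm : ∀ i ≤ a + 1, 2 ≤ m i) :
    (catPrefix m (a + 1)).1.card = (catPrefix m a).1.card * 2 ^ (m (a + 1) - 2) +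
      (catPrefix m a).2.card * 2 ^ (m (a + 1) - 1) ∧
    (catPrefix m (a + 1)).2.card = (catPrefix m a).1.card * 2 ^ (m (a + 1) - 2) +
      (catPrefix m a).2.card * (2 ^ (m (a + 1) - 1) - 1) := by
  classical
  have ha := hm (a + 1) le_rfl
  have ih1 := fun f => (catPrefixValid_of_mem (m := m) (a := a) (fun i hi => hm i (by omega)) (f := f)).1
  have ih2 := fun f => (catPrefixValid_of_mem (m := m) (a := a) (fun i hi => hm i (by omega)) (f := f)).2
  have hdis : ∀ C D, Disjoint (catExtend (catPrefix m a).1 (a + 1) C)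
      (catExtend (catPrefix m a).2 (a + 1) D) := by
    intro C D
    rw [Finset.disjoint_left]
    intro f hf hf'
    obtain ⟨g, hg, X, -, rfl⟩ := mem_catExtend.1 hf
    obtain ⟨g', hg', X', -, h⟩ := mem_catExtend.1 hf'
    have := congrFun h a
    rw [Function.update_of_ne (by omega), Function.update_of_ne (by omega)] at this
    exact (ih2 g' hg').2 (this ▸ (ih1 g hg).2)
  have c1 := fun C => card_catExtend (F := (catPrefix m a).1) (i := a + 1) C
    fun f hf => (ih1 f hf).1.outside _ (by omega)
  have c2 := fun C => card_catExtend (F := (catPrefix m a).2) (i := a + 1) C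
    fun f hf => (ih2 f hf).1.outside _ (by omega)
  constructor
  · rw [catPrefix, Finset.card_union_of_disjoint (hdis _ _), c1, c2, Finset.card_Icc_finset,
      Finset.card_Icc_finset, Finset.card_pair (by omega), Finset.card_range,
      Finset.card_singleton]
    · intro x hx
      rw [Finset.mem_singleton] at hx
      rw [Finset.mem_range]
      omega
    · intro x hx
      rw [Finset.mem_insert, Finset.mem_singleton] at hx
      rw [Finset.mem_range]
      omega
  · rw [catPrefix, Finset.card_union_of_disjoint (hdis _ _), c1, c2, Finset.card_Icc_finset,
      Finset.card_erase_of_mem (Finset.empty_mem_powerset _), Finset.card_powerset,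
      Finset.card_range, Finset.card_singleton, Nat.sub_sub]
    intro x hx
    rw [Finset.mem_singleton] at hx
    rw [Finset.mem_range]
    omega

/-- The set of valid states has the expected size. -/
theorem exists_finset_catValid {k : ℕ} {m : ℕ → ℕ} (hm : ∀ i ≤ k, 2 ≤ m i) :
    ∃ V : Finset (ℕ → Finset ℕ), (∀ f ∈ V, CatValid (k + 1) m f) ∧
      V.card = ∑ a ∈ Finset.range (k + 1), (catPrefix m a).2.card + (catPrefix m k).1.card := by
  classical
  have h1 := fun a (ha : a ≤ k) f =>
    (catPrefixValid_of_mem (m := m) (a := a) (fun i hi => hm i (by omega)) (f := f)).1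
  have h2 := fun a (ha : a ≤ k) f =>
    (catPrefixValid_of_mem (m := m) (a := a) (fun i hi => hm i (by omega)) (f := f)).2
  have hval : ∀ a ≤ k, ∀ f, CatPrefixValid m a f → (a < k → m a - 1 ∉ f a) →
      CatValid (k + 1) m f := by
    intro a ha f hf hl
    refine ⟨hf.zero, hf.lt, fun i hi => hf.outside i (by omega), ?_, ?_⟩
    · intro i hi
      apply hf.outside
      by_contra h
      exact hf.nonempty i (by omega) hi
    · intro i hi hi2
      rcases lt_trichotomy i a with h | h | h
      · exact hf.final i h hi2
      · subst h
        exact absurd hi2 (hl (by omega))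
      · rw [hf.outside i h] at hi2
        simp at hi2
  -- The vectors are sorted by their last nonempty component `a`. For `a < k` it cannot contain its
  -- final state, which would force `0` into the empty component `a + 1`; for `a = k` both kinds
  -- occur.
  refine ⟨(Finset.range (k + 1)).biUnion (fun a => (catPrefix m a).2) ∪ (catPrefix m k).1,
    ?_, ?_⟩
  · intro f hf
    rcases Finset.mem_union.1 hf with hf | hf
    · obtain ⟨a, ha, hf⟩ := Finset.mem_biUnion.1 hf
      rw [Finset.mem_range] at ha
      have := h2 a (by omega) f hf
      exact hval a (by omega) f this.1 fun _ => this.2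
    · exact hval k le_rfl f (h1 k le_rfl f hf).1 fun h => absurd h (lt_irrefl _)
  · have huniq : ∀ a b f, CatPrefixValid m a f → CatPrefixValid m b f → a ≤ b := by
      intro a b f ha hb
      by_contra h
      exact ha.nonempty a le_rfl (hb.outside a (by omega))
    rw [Finset.card_union_of_disjoint, Finset.card_biUnion]
    · intro a ha b hb hab
      rw [Finset.mem_coe, Finset.mem_range] at ha hb
      change Disjoint (catPrefix m a).2 (catPrefix m b).2
      rw [Finset.disjoint_left]
      intro f hfa hfb
      have ha' := (h2 a (by omega) f hfa).1
      have hb' := (h2 b (by omega) f hfb).1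
      exact hab ((huniq a b f ha' hb').antisymm (huniq b a f hb' ha'))
    · rw [Finset.disjoint_left]
      intro f hf hf'
      obtain ⟨a, ha, hf⟩ := Finset.mem_biUnion.1 hf
      rw [Finset.mem_range] at ha
      have ha' := h2 a (by omega) f hf
      have hk' := h1 k le_rfl f hf'
      obtain rfl := (huniq a k f ha'.1 hk'.1).antisymm (huniq k a f hk'.1 ha'.1)
      exact ha'.2 hk'.2

/-! ### Matching the count with the formula -/

/-- With `P = 2 ^ (n_{j+1} + ⋯ + n_k)`, the recursion of `catNest` gives `2 ^ n_j P - T_j = (P - 1)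
+ (2 ^ n_j - 1) (P - T_{j+1})`; iterating this yields the sum. -/
theorem two_pow_sub_catNest (n : ℕ → ℕ) (k r : ℕ) : ∀ j, 1 ≤ j → j + r = k + 1 →
    (2 : ℤ) ^ (∑ l ∈ Finset.Icc j k, n l) - catNest n j r =
      ∑ t ∈ Finset.Icc j k, (∏ l ∈ Finset.Icc j (t - 1), ((2 : ℤ) ^ n l - 1)) *
        ((2 : ℤ) ^ (∑ l ∈ Finset.Icc (t + 1) k, n l) - 1) := by
  induction r with
  | zero =>
    intro j hj1 hj
    rw [Finset.Icc_eq_empty (by omega)]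
    simp [catNest]
  | succ r ih =>
    intro j hj1 hj
    have ih := ih (j + 1) (by omega) (by omega)
    have hjk : j ≤ k := by omega
    have hprod : ∀ t ∈ Finset.Icc (j + 1) k,
        (∏ l ∈ Finset.Icc j (t - 1), ((2 : ℤ) ^ n l - 1)) *
          ((2 : ℤ) ^ (∑ l ∈ Finset.Icc (t + 1) k, n l) - 1) =
        ((2 : ℤ) ^ n j - 1) * ((∏ l ∈ Finset.Icc (j + 1) (t - 1), ((2 : ℤ) ^ n l - 1)) *
          ((2 : ℤ) ^ (∑ l ∈ Finset.Icc (t + 1) k, n l) - 1)) := by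
      intro t ht
      rw [Finset.mem_Icc] at ht
      rw [← Finset.insert_Icc_add_one_left_eq_Icc (by omega : j ≤ t - 1),
        Finset.prod_insert (by simp), mul_assoc]
    rw [← Finset.insert_Icc_add_one_left_eq_Icc hjk, Finset.sum_insert (by simp),
      Finset.sum_insert (by simp), Finset.sum_congr rfl hprod, ← Finset.mul_sum, ← ih,
      Finset.Icc_eq_empty (by omega : ¬j ≤ j - 1), Finset.prod_empty, pow_add, catNest]
    ring

/-- The sum of the weights of the nonempty prefixes of length `a + 1` that end in a final state. -/
def catFinalSum (n : ℕ → ℕ) (a : ℕ) : ℤ :=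
  ∑ S ∈ (Finset.Icc 1 a).powerset, ∏ j ∈ Finset.Icc 1 (a + 1), catFactor n (insert (a + 1) S) j

/-- The sum of the weights of the nonempty prefixes of length `a + 1` that do not. -/
def catNonfinalSum (n : ℕ → ℕ) (a : ℕ) : ℤ :=
  ∑ S ∈ (Finset.Icc 1 a).powerset, ∏ j ∈ Finset.Icc 1 (a + 1), catFactor n S j

theorem prod_catFactor_insert (n : ℕ → ℕ) (a : ℕ) (S : Finset ℕ) :
    ∏ j ∈ Finset.Icc 1 (a + 1), catFactor n (insert (a + 2) S) j =
      ∏ j ∈ Finset.Icc 1 (a + 1), catFactor n S j := by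
  apply Finset.prod_congr rfl
  intro j hj
  rw [Finset.mem_Icc] at hj
  unfold catFactor
  simp only [Finset.mem_insert, show j - 1 ≠ a + 2 by omega, show j ≠ a + 2 by omega,
    show 1 ≠ a + 2 by omega, false_or]

/-- The sum is split by whether `a + 1 ∈ S`, which decides the new factor at position `a + 2`. -/
theorem catFinalSum_succ (n : ℕ → ℕ) (a : ℕ) : catFinalSum n (a + 1) =
    catFinalSum n a * 2 ^ (n (a + 2) - 2) + catNonfinalSum n a * 2 ^ (n (a + 2) - 1) := by
  have hmem : a + 1 ∉ Finset.Icc 1 a := by simp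
  unfold catFinalSum catNonfinalSum
  have hI : Finset.Icc 1 (a + 1) = insert (a + 1) (Finset.Icc 1 a) :=
    (Finset.insert_Icc_right_eq_Icc_succ (by simp)).symm
  rw [congrArg Finset.powerset hI,
    Finset.sum_powerset_insert hmem, add_comm, Finset.sum_mul, Finset.sum_mul]
  congr 1 <;> apply Finset.sum_congr rfl <;> intro S hS
  · rw [Finset.prod_Icc_succ_top (b := a + 1) (by omega), prod_catFactor_insert]
    congr 1
    simp [catFactor]
  · have h1 : a + 1 ∉ S := fun h => hmem (Finset.mem_powerset.1 hS h)
    rw [Finset.prod_Icc_succ_top (b := a + 1) (by omega), prod_catFactor_insert]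
    congr 1
    simp [catFactor, h1]

theorem catNonfinalSum_succ (n : ℕ → ℕ) (a : ℕ) : catNonfinalSum n (a + 1) =
    catFinalSum n a * 2 ^ (n (a + 2) - 2) + catNonfinalSum n a * (2 ^ (n (a + 2) - 1) - 1) := by
  have hmem : a + 1 ∉ Finset.Icc 1 a := by simp
  unfold catFinalSum catNonfinalSum
  have hI : Finset.Icc 1 (a + 1) = insert (a + 1) (Finset.Icc 1 a) :=
    (Finset.insert_Icc_right_eq_Icc_succ (by simp)).symm
  rw [congrArg Finset.powerset hI,
    Finset.sum_powerset_insert hmem, add_comm, Finset.sum_mul, Finset.sum_mul]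
  congr 1 <;> apply Finset.sum_congr rfl <;> intro S hS
  · rw [Finset.prod_Icc_succ_top (b := a + 1) (by omega)]
    congr 1
    simp [catFactor]
  · have h1 : a + 1 ∉ S := fun h => hmem (Finset.mem_powerset.1 hS h)
    have h2 : a + 2 ∉ S := fun h => by simpa using Finset.mem_powerset.1 hS h
    rw [Finset.prod_Icc_succ_top (b := a + 1) (by omega)]
    congr 1
    simp [catFactor, h1, h2]

theorem catE_succ (k : ℕ) (n : ℕ → ℕ) (a : ℕ) : catE (k + 1) n (a + 1) =
    catFinalSum n a *
      (1 + ((2 : ℤ) ^ (n (a + 2) - 1) - 1) * catNest n (a + 3) (k - (a + 1))) := by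
  unfold catE catFinalSum
  rw [Finset.sum_mul, Nat.add_sub_cancel, Nat.add_sub_add_right]

/-- One sieving step: unfolding `T_{i+2}` offers each prefix an arbitrary continuation. Stopping
after a nonfinal prefix is valid and gives `catNonfinalSum n i`. After a final prefix, stopping or
continuing with a nonempty set lacking `0` is a violation, and these cases add up to `E_{i+1}`. The
valid extensions carry the factor `T_{i+3}`. -/
theorem mul_catNest_eq {k : ℕ} {n : ℕ → ℕ} (hn : ∀ i, 1 ≤ i → i ≤ k + 1 → 2 ≤ n i) (i : ℕ)
    (hi : i ≤ k) : (n 1 : ℤ) * catNest n 2 k =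
      (catNonfinalSum n i + catFinalSum n i) * catNest n (i + 2) (k - i) +
        ∑ a ∈ Finset.range i, (catNonfinalSum n a + catE (k + 1) n (a + 1)) := by
  induction i with
  | zero => simp [catNonfinalSum, catFinalSum, catFactor]
  | succ i ih =>
    rw [ih (by omega), Finset.sum_range_succ, catE_succ, catNonfinalSum_succ, catFinalSum_succ,
      show k - i = k - (i + 1) + 1 by omega, catNest]
    -- This removes the truncated subtractions in the exponents, so that `ring` applies.
    obtain ⟨c, hc⟩ : ∃ c, n (i + 2) = c + 2 :=
      ⟨n (i + 2) - 2, by have := hn (i + 2) (by omega) (by omega); omega⟩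
    rw [hc, Nat.add_sub_cancel, show c + 2 - 1 = c + 1 by omega]
    ring

/-- The summand of `S` counts the prefixes in which exactly the positions in `S` (with the last one
added in the final case) contain their final state; formally, both sides obey the same recursion. -/
theorem card_catPrefix {k : ℕ} {n : ℕ → ℕ} (hn : ∀ i, 1 ≤ i → i ≤ k + 1 → 2 ≤ n i) (a : ℕ)
    (ha : a ≤ k) :
    ((catPrefix (fun i => n (i + 1)) a).1.card : ℤ) = catFinalSum n a ∧
      ((catPrefix (fun i => n (i + 1)) a).2.card : ℤ) = catNonfinalSum n a := by
  induction a with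
  | zero =>
    have h1 := hn 1 le_rfl (by omega)
    obtain ⟨h2, h3⟩ := card_catPrefix_zero fun i => n (i + 1)
    simp only [zero_add] at h3
    rw [h2, h3, Nat.cast_sub (by omega)]
    simp [catNonfinalSum, catFinalSum, catFactor]
  | succ a ih =>
    obtain ⟨h1, h2⟩ := ih (by omega)
    obtain ⟨h3, h4⟩ := card_catPrefix_succ (m := fun i => n (i + 1)) (a := a)
      fun i hi => hn (i + 1) (by omega) (by omega)
    rw [h3, h4, catFinalSum_succ, catNonfinalSum_succ]
    push_cast [Nat.one_le_two_pow]
    rw [h1, h2]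
    exact ⟨rfl, rfl⟩

theorem mul_two_pow_sub_catD (k : ℕ) (n : ℕ → ℕ) :
    (n 1 : ℤ) * 2 ^ (∑ j ∈ Finset.Icc 2 (k + 1), n j) - catD (k + 1) n =
      n 1 * catNest n 2 k := by
  have h := two_pow_sub_catNest n (k + 1) k 2 (by omega) (by omega)
  have hD : catD (k + 1) n = n 1 *
      ((2 : ℤ) ^ (∑ l ∈ Finset.Icc 2 (k + 1), n l) - catNest n 2 k) := by
    rw [h, catD, Nat.add_sub_cancel, Finset.mul_sum]
    simp only [← mul_assoc]
    -- `catD` stops one index earlier than the telescoped sum; the extra term has the factor `2 ^ 0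
    -- - 1 = 0`.
    rcases Nat.eq_zero_or_pos k with rfl | hk
    · rfl
    · rw [Finset.sum_Icc_succ_top (by omega : 2 ≤ k + 1), Finset.Icc_eq_empty (by omega : ¬k + 1 + 1 ≤ k + 1)]
      simp
  rw [hD]
  ring

theorem mainTheorem5 (k : ℕ) (hk : 1 ≤ k) (n : ℕ → ℕ)
    (hn : ∀ i, 1 ≤ i → i ≤ k → 2 ≤ n i) :
    ∃ A : (i : Fin k) → DFA (Fin (2 * k - 1)) (Fin (n (i.val + 1))),
      ∀ (σ : Type*) [Fintype σ] (B : DFA (Fin (2 * k - 1)) σ),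
        B.accepts = (List.ofFn fun i : Fin k => (A i).accepts).prod →
        (n 1 : ℤ) * 2 ^ (∑ j ∈ Finset.Icc 2 k, n j) - catD k n
            - ∑ i ∈ Finset.Icc 1 (k - 1), catE k n i
          ≤ (Fintype.card σ : ℤ) := by
  set m : ℕ → ℕ := fun i => n (i + 1) with hmdef
  have hm : ∀ i < k, 2 ≤ m i := fun i hi => hn (i + 1) (by omega) (by omega)
  refine ⟨fun i => catDFA (2 * k - 1) m i (by have := hm i i.2; omega), ?_⟩
  intro σ _ B hB
  simp only [accepts_catDFA, prod_ofFn_catLang] at hB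
  obtain ⟨K, rfl⟩ : ∃ K, k = K + 1 := ⟨k - 1, by omega⟩
  obtain ⟨V, hV, hcard⟩ := exists_finset_catValid (k := K) (m := m) fun i hi => hm i (by omega)
  refine le_trans (le_of_eq ?_) (Int.ofNat_le.2 (card_le_of_accepts_eq hk hm B hB V hV))
  have h1 : ∀ a ∈ Finset.range K, ((catPrefix m a).2.card : ℤ) = catNonfinalSum n a :=
    fun a ha => (card_catPrefix hn a (Finset.mem_range.1 ha).le).2
  have h2 : ∑ i ∈ Finset.Icc 1 K, catE (K + 1) n i =
      ∑ a ∈ Finset.range K, catE (K + 1) n (a + 1) := by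
    rw [Finset.range_eq_Ico, Finset.sum_Ico_add' (fun i => catE (K + 1) n i) 0 K 1]
    rfl
  -- At `i = K` the remaining nest is `1`, so the sieve leaves exactly the cardinality of `V` plus
  -- the sum of the `E_i`.
  rw [mul_two_pow_sub_catD, mul_catNest_eq hn K le_rfl, hcard, Nat.add_sub_cancel, h2,
    Finset.sum_add_distrib, Nat.sub_self, catNest]
  push_cast
  rw [Finset.sum_range_succ, Finset.sum_congr rfl h1, (card_catPrefix hn K le_rfl).1,
    (card_catPrefix hn K le_rfl).2]
  ring
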